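/- Let $n\ge 1$, let $\mathcal A$ be an AB3 abelian category (i.e. $\mathcal A$ has all small coproducts), let $\mathcal D(\mathcal A)$ be its (unbounded) derived category with suspension $\Sigma$, let $\mathbf t=(\mathcal D^{\le 0},\mathcal D^{\ge 0})$ be the standard $t$-structure on $\mathcal D(\mathcal A)$, and let $$\mathcal C_{n+1}:=\mathcal D^{\ge 0}\cap\Sigma^{-n}\mathcal D^{\le 0}.$$ The full subcategory $\mathcal C_{n+1}$ of $\mathcal D(\mathcal A)$ is closed under extensions, and is viewed as an extriangulated category with $\mathbb E(Z,X)=\operatorname{Hom}_{\mathcal D(\mathcal A)}(Z,\Sigma X)$, where $\delta\in\mathbb E(Z,X)$ is realized by $X\to Y\to Z$ if and only if $X\to Y\to Z\xrightarrow{\ \delta\ }\Sigma X$ is a distinguished triangle. *Definitions.* * The global dimension of $\mathbf t$ is $\operatorname{gl.dim.}(\mathbf t)=\min\{k\in\mathbb N \mid \operatorname{Hom}(W,\Sigma^{k+1}U)=0 \text{ for all } W\in\mathcal D^{\ge 0},\ U\in\mathcal D^{\le 0}\}$ (and $\infty$ if there is no such $k$). * $\mathbf t$ is *smashing* if $\mathcal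 D^{\ge 0}$ is closed under small coproducts in $\mathcal D(\mathcal A)$: every small family of objects of $\mathcal D^{\ge 0}$ has a coproduct in $\mathcal D(\mathcal A)$, and this coproduct belongs to $\mathcal D^{\ge 0}$. * Let $(\mathcal C,\mathbb E,\mathfrak s)$ be an extriangulated category. It is *AET3.5* if for every non-empty small set $I$ all coproducts indexed by $I$ exist in $\mathcal C$ and there are group homomorphisms $$\Gamma_{(Z_i),X}:\prod_{i\in I}\mathbb E(Z_i,X)\longrightarrow \mathbb E\Big(\coprod_{i\in I}Z_i,\;X^{(I)}\Big),$$ natural in $X\in\mathcal C$ and in $(Z_i)_{i\in I}\in\mathcal C^I$, such that whenever $\eta_i$ is realized by $X\xrightarrow{x_i}Y_i\xrightarrow{y_i}Z_i$ for every $i\in I$, then $\Gamma(\eta)$ is realized by $X^{(I)}\xrightarrow{\coprod x_i}\coprod_i Y_i\xrightarrow{\coprod y_i}\coprod_i Z_i$. It is *AET4* if, for every non-empty small set $I$, all coproducts indexed by $I$ exist and $\Gamma$ as above can be chosen such that moreover $\mu_i^X\cdot\eta_i=\Gamma(\eta)\cdot\mu_i^Z$ for all $\eta=(\eta_i)_{i\in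 I}$ and all $i\in I$, where $\mu^X_i:X\to X^{(I)}$ and $\mu^Z_i:Z_i\to\coprod_j Z_j$ are the canonical inclusions. **Statement.** If $\operatorname{gl.dim.}(\mathbf t)\le n$, then the following are equivalent: (a) $\mathbf t$ is smashing; (b) $\mathcal C_{n+1}$ is AET4; (c) $\mathcal C_{n+1}$ is AET3.5. -/

import Mathlib

open CategoryTheory Category Limits Pretriangulated Triangulated

universe t w v u

namespace AET

/-! ### Extriangulated categories -/

/-- The structure `(𝔼, 𝔰)` of an extriangulated category on an additive category `C`.
`Ext Z X` is the group `𝔼(Z, X)`, `push a δ` is `a · δ`, `pull c δ` is `δ · c`, and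
`Realizes δ x y` says that the sequence `X ⟶ Y ⟶ Z` belongs to the equivalence class `𝔰(δ)`. -/
structure Extriangulation (C : Type u) [Category.{v} C] [Preadditive C] [HasZeroObject C]
    [HasBinaryBiproducts C] where
  Ext : C → C → Type w
  [addCommGroup : ∀ Z X : C, AddCommGroup (Ext Z X)]
  push {Z X X' : C} (a : X ⟶ X') : Ext Z X →+ Ext Z X'
  pull {Z' Z X : C} (c : Z' ⟶ Z) : Ext Z X →+ Ext Z' X
  push_id {Z X : C} (δ : Ext Z X) : push (𝟙 X) δ = δ
  push_comp {Z X X' X'' : C} (a : X ⟶ X') (a' : X' ⟶ X'') (δ : Ext Z X) :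
    push (a ≫ a') δ = push a' (push a δ)
  pull_id {Z X : C} (δ : Ext Z X) : pull (𝟙 Z) δ = δ
  pull_comp {Z'' Z' Z X : C} (c' : Z'' ⟶ Z') (c : Z' ⟶ Z) (δ : Ext Z X) :
    pull (c' ≫ c) δ = pull c' (pull c δ)
  push_pull {Z' Z X X' : C} (a : X ⟶ X') (c : Z' ⟶ Z) (δ : Ext Z X) :
    push a (pull c δ) = pull c (push a δ)
  push_add {Z X X' : C} (a a' : X ⟶ X') (δ : Ext Z X) : push (a + a') δ = push a δ + push a' δ
  pull_add {Z' Z X : C} (c c' : Z' ⟶ Z) (δ : Ext Z X) : pull (c + c') δ = pull c δ + pull c' δ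
  Realizes {X Y Z : C} (δ : Ext Z X) (x : X ⟶ Y) (y : Y ⟶ Z) : Prop
  /-- Every extension is realized. -/
  exists_realizes {X Z : C} (δ : Ext Z X) : ∃ (Y : C) (x : X ⟶ Y) (y : Y ⟶ Z), Realizes δ x y
  /-- The realizations of `δ` form exactly one equivalence class of sequences. -/
  realizes_iff {X Y Y' Z : C} (δ : Ext Z X) (x : X ⟶ Y) (y : Y ⟶ Z) (x' : X ⟶ Y') (y' : Y' ⟶ Z) :
    Realizes δ x y → (Realizes δ x' y' ↔ ∃ e : Y ≅ Y', x ≫ e.hom = x' ∧ e.hom ≫ y' = y)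
  /-- `𝔰` is a realization: every morphism of extensions is realized. -/
  exists_hom {X Y Z X' Y' Z' : C} {δ : Ext Z X} {δ' : Ext Z' X'} {x : X ⟶ Y} {y : Y ⟶ Z}
    {x' : X' ⟶ Y'} {y' : Y' ⟶ Z'} (h : Realizes δ x y) (h' : Realizes δ' x' y')
    (a : X ⟶ X') (c : Z ⟶ Z') (hac : push a δ = pull c δ') :
    ∃ b : Y ⟶ Y', x ≫ b = a ≫ x' ∧ y ≫ c = b ≫ y'
  /-- `𝔰` is additive. -/
  realizes_zero (X Z : C) :
    Realizes (0 : Ext Z X) (biprod.inl : X ⟶ X ⊞ Z) (biprod.snd : X ⊞ Z ⟶ Z)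
  realizes_sum {X Y Z X' Y' Z' : C} {δ : Ext Z X} {δ' : Ext Z' X'} {x : X ⟶ Y} {y : Y ⟶ Z}
    {x' : X' ⟶ Y'} {y' : Y' ⟶ Z'} (h : Realizes δ x y) (h' : Realizes δ' x' y') :
    Realizes (push (biprod.inl : X ⟶ X ⊞ X') (pull (biprod.fst : Z ⊞ Z' ⟶ Z) δ) +
      push (biprod.inr : X' ⟶ X ⊞ X') (pull (biprod.snd : Z ⊞ Z' ⟶ Z') δ'))
      (biprod.map x x') (biprod.map y y')
  /-- Axiom (ET3). -/
  et3 {X Y Z X' Y' Z' : C} {δ : Ext Z X} {δ' : Ext Z' X'} {x : X ⟶ Y} {y : Y ⟶ Z}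
    {x' : X' ⟶ Y'} {y' : Y' ⟶ Z'} (h : Realizes δ x y) (h' : Realizes δ' x' y')
    (a : X ⟶ X') (b : Y ⟶ Y') (hab : x ≫ b = a ≫ x') :
    ∃ c : Z ⟶ Z', y ≫ c = b ≫ y' ∧ push a δ = pull c δ'
  /-- Axiom (ET3)ᵒᵖ. -/
  et3_op {X Y Z X' Y' Z' : C} {δ : Ext Z X} {δ' : Ext Z' X'} {x : X ⟶ Y} {y : Y ⟶ Z}
    {x' : X' ⟶ Y'} {y' : Y' ⟶ Z'} (h : Realizes δ x y) (h' : Realizes δ' x' y')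
    (b : Y ⟶ Y') (c : Z ⟶ Z') (hbc : y ≫ c = b ≫ y') :
    ∃ a : X ⟶ X', x ≫ b = a ≫ x' ∧ push a δ = pull c δ'
  /-- Axiom (ET4). -/
  et4 {A B D K F : C} {δ : Ext D A} {δ' : Ext F B} {f : A ⟶ B} {f' : B ⟶ D} {g : B ⟶ K}
    {g' : K ⟶ F} (h : Realizes δ f f') (h' : Realizes δ' g g') :
    ∃ (G : C) (k : K ⟶ G) (d : D ⟶ G) (e : G ⟶ F) (δ'' : Ext G A),
      Realizes δ'' (f ≫ g) k ∧ f' ≫ d = g ≫ k ∧ k ≫ e = g' ∧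
      Realizes (push f' δ') d e ∧ pull d δ'' = δ ∧ push f δ'' = pull e δ'
  /-- Axiom (ET4)ᵒᵖ. -/
  et4_op {A B D K F : C} {δ : Ext B D} {δ' : Ext K F} {f' : D ⟶ A} {f : A ⟶ B} {g' : F ⟶ B}
    {g : B ⟶ K} (h : Realizes δ f' f) (h' : Realizes δ' g' g) :
    ∃ (G : C) (k : G ⟶ A) (d : D ⟶ G) (e : G ⟶ F) (δ'' : Ext K G),
      Realizes δ'' k (f ≫ g) ∧ d ≫ k = f' ∧ k ≫ f = e ≫ g' ∧
      Realizes (pull g' δ) d e ∧ push e δ'' = δ' ∧ push d δ = pull g δ''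

attribute [instance] Extriangulation.addCommGroup

/-! ### The conditions AET3, AET3.5 and AET4 -/

namespace Extriangulation

variable {C : Type u} [Category.{v} C] [Preadditive C] [HasZeroObject C] [HasBinaryBiproducts C]

/-- The data showing that the coproduct functor `S = ∐ : Fun(I, C) ⥤ C` is
`(1, T)`-extriangulated, where `T : C ⥤ Fun(I, C)` is the constant functor and `Fun(I, C)` carries
the componentwise extriangulated structure: a natural transformation
`Γ : ∏ᵢ 𝔼(Zᵢ, X) ⟶ 𝔼(∐ᵢ Zᵢ, X^(I))` of functors to abelian groups, such that `Γ (ηᵢ)ᵢ` is realized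
by the coproduct of any realizations of the `ηᵢ`. -/
structure CoproductExtriangulated (E : Extriangulation.{w} C) (I : Type*)
    [HasCoproductsOfShape I C] where
  Γ (Z : I → C) (X : C) : (∀ i, E.Ext (Z i) X) →+ E.Ext (∐ Z) (∐ fun _ : I ↦ X)
  naturality {Z Z' : I → C} {X X' : C} (c : ∀ i, Z' i ⟶ Z i) (a : X ⟶ X')
    (η : ∀ i, E.Ext (Z i) X) :
    Γ Z' X' (fun i ↦ E.push a (E.pull (c i) (η i))) =
      E.push (Limits.Sigma.map fun _ ↦ a) (E.pull (Limits.Sigma.map c) (Γ Z X η))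
  realizes {Z : I → C} {X : C} (η : ∀ i, E.Ext (Z i) X) (Y : I → C) (x : ∀ i, X ⟶ Y i)
    (y : ∀ i, Y i ⟶ Z i) (h : ∀ i, E.Realizes (η i) (x i) (y i)) :
    E.Realizes (Γ Z X η) (Limits.Sigma.map x) (Limits.Sigma.map y)

/-- AET3: all coproducts indexed by non-empty sets exist. -/
def IsAET3 (_E : Extriangulation.{w} C) : Prop :=
  ∀ (I : Type t) [Nonempty I], HasCoproductsOfShape I C

/-- AET3.5: AET3 holds and, for every non-empty set `I`, the coproduct functor
`∐ : Fun(I, C) ⥤ C` is `(1, T)`-extriangulated. -/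
def IsAET35 (E : Extriangulation.{w} C) : Prop :=
  ∀ (I : Type t) [Nonempty I], ∃ _ : HasCoproductsOfShape I C,
    Nonempty (E.CoproductExtriangulated I)

/-- AET4: AET3.5 holds and, for every non-empty set `I`, the unit `1 ⟶ T ∘ ∐` is
`(1, T)`-extriangulated, i.e. `μᵢ · ηᵢ = Γ(η) · μᵢ` for the coproduct inclusions `μᵢ`. -/
def IsAET4 (E : Extriangulation.{w} C) : Prop :=
  ∀ (I : Type t) [Nonempty I], ∃ (_ : HasCoproductsOfShape I C)
    (S : E.CoproductExtriangulated I),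
    ∀ (Z : I → C) (X : C) (η : ∀ i, E.Ext (Z i) X) (i : I),
      E.push (Limits.Sigma.ι (fun _ : I ↦ X) i) (η i) =
        E.pull (Limits.Sigma.ι Z i) (S.Γ Z X η)

end Extriangulation

/-! ### Extension-closed subcategories of triangulated categories -/

section Triangulated

variable {D : Type u} [Category.{v} D] [Preadditive D] [HasZeroObject D] [HasShift D ℤ]
  [∀ n : ℤ, (shiftFunctor D n).Additive] [Pretriangulated D]

theorem isIso_of_projections {X : D} (F : Bool → D) (f : X ⟶ ∏ᶜ F) {p : X ⟶ F true}
    {q : X ⟶ F false} (hp : f ≫ Pi.π F true = p) (hq : f ≫ Pi.π F false = q)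
    {i : F true ⟶ X} {j : F false ⟶ X} (a : i ≫ p = 𝟙 _) (b : j ≫ q = 𝟙 _) (c : i ≫ q = 0)
    (d : j ≫ p = 0) (e : p ≫ i + q ≫ j = 𝟙 _) : IsIso f := by
  refine ⟨Pi.π F true ≫ i + Pi.π F false ≫ j, ?_, ?_⟩
  · rw [Preadditive.comp_add, ← Category.assoc, ← Category.assoc, hp, hq, e]
  · have h₁ : i ≫ f ≫ Pi.π F true = 𝟙 _ := by rw [hp, a]
    have h₂ : i ≫ f ≫ Pi.π F false = 0 := by rw [hq, c]
    have h₃ : j ≫ f ≫ Pi.π F true = 0 := by rw [hp, d]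
    have h₄ : j ≫ f ≫ Pi.π F false = 𝟙 _ := by rw [hq, b]
    apply Pi.hom_ext
    rintro (_ | _) <;> simp [h₁, h₂, h₃, h₄]

/-- A triangle which is a biproduct of two distinguished triangles is distinguished. -/
theorem distinguished_of_projections {X Y Z X₁ Y₁ Z₁ X₂ Y₂ Z₂ : D}
    {x : X ⟶ Y} {y : Y ⟶ Z} {δ : Z ⟶ X⟦(1 : ℤ)⟧}
    {x₁ : X₁ ⟶ Y₁} {y₁ : Y₁ ⟶ Z₁} {δ₁ : Z₁ ⟶ X₁⟦(1 : ℤ)⟧}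
    {x₂ : X₂ ⟶ Y₂} {y₂ : Y₂ ⟶ Z₂} {δ₂ : Z₂ ⟶ X₂⟦(1 : ℤ)⟧}
    (h₁ : Triangle.mk x₁ y₁ δ₁ ∈ distTriang D) (h₂ : Triangle.mk x₂ y₂ δ₂ ∈ distTriang D)
    {pX : X ⟶ X₁} {qX : X ⟶ X₂} {iX : X₁ ⟶ X} {jX : X₂ ⟶ X}
    {pY : Y ⟶ Y₁} {qY : Y ⟶ Y₂} {iY : Y₁ ⟶ Y} {jY : Y₂ ⟶ Y}
    {pZ : Z ⟶ Z₁} {qZ : Z ⟶ Z₂} {iZ : Z₁ ⟶ Z} {jZ : Z₂ ⟶ Z}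
    (a₁ : iX ≫ pX = 𝟙 X₁) (b₁ : jX ≫ qX = 𝟙 X₂) (c₁ : iX ≫ qX = 0) (d₁ : jX ≫ pX = 0)
    (e₁ : pX ≫ iX + qX ≫ jX = 𝟙 X)
    (a₂ : iY ≫ pY = 𝟙 Y₁) (b₂ : jY ≫ qY = 𝟙 Y₂) (c₂ : iY ≫ qY = 0) (d₂ : jY ≫ pY = 0)
    (e₂ : pY ≫ iY + qY ≫ jY = 𝟙 Y)
    (a₃ : iZ ≫ pZ = 𝟙 Z₁) (b₃ : jZ ≫ qZ = 𝟙 Z₂) (c₃ : iZ ≫ qZ = 0) (d₃ : jZ ≫ pZ = 0)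
    (e₃ : pZ ≫ iZ + qZ ≫ jZ = 𝟙 Z)
    (p₁ : x ≫ pY = pX ≫ x₁) (p₂ : y ≫ pZ = pY ≫ y₁) (p₃ : δ ≫ pX⟦1⟧' = pZ ≫ δ₁)
    (q₁ : x ≫ qY = qX ≫ x₂) (q₂ : y ≫ qZ = qY ≫ y₂) (q₃ : δ ≫ qX⟦1⟧' = qZ ≫ δ₂) :
    Triangle.mk x y δ ∈ distTriang D := by
  let F : Bool → Triangle D :=
    fun b ↦ Bool.rec (Triangle.mk x₂ y₂ δ₂) (Triangle.mk x₁ y₁ δ₁) b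
  have hF : ∀ b, F b ∈ distTriang D := fun b ↦ by cases b; exacts [h₂, h₁]
  let φ : Triangle.mk x y δ ⟶ productTriangle F := productTriangle.lift F
    (fun b ↦ Bool.rec (Triangle.homMk (Triangle.mk x y δ) (Triangle.mk x₂ y₂ δ₂) qX qY qZ q₁ q₂ q₃)
      (Triangle.homMk (Triangle.mk x y δ) (Triangle.mk x₁ y₁ δ₁) pX pY pZ p₁ p₂ p₃) b)
  have k₁ : IsIso φ.hom₁ := isIso_of_projections (fun b ↦ (F b).obj₁) φ.hom₁
    (limit.lift_π _ _) (limit.lift_π _ _) a₁ b₁ c₁ d₁ e₁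
  have k₂ : IsIso φ.hom₂ := isIso_of_projections (fun b ↦ (F b).obj₂) φ.hom₂
    (limit.lift_π _ _) (limit.lift_π _ _) a₂ b₂ c₂ d₂ e₂
  have k₃ : IsIso φ.hom₃ := isIso_of_projections (fun b ↦ (F b).obj₃) φ.hom₃
    (limit.lift_π _ _) (limit.lift_π _ _) a₃ b₃ c₃ d₃ e₃
  have := Triangle.isIso_of_isIsos φ k₁ k₂ k₃
  exact isomorphic_distinguished _ (productTriangle_distinguished F hF) _ (asIso φ)

variable (P : ObjectProperty D) [P.ContainsZero] [P.IsClosedUnderIsomorphisms]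
  [P.IsTriangulatedClosed₂]

instance fullSubcategory_hasBinaryBiproducts : HasBinaryBiproducts P.FullSubcategory := by
  have hP : ∀ X Y : P.FullSubcategory, P (X.obj ⊞ Y.obj) := fun X Y ↦
    P.ext_of_isTriangulatedClosed₂ _ (binaryBiproductTriangle_distinguished X.obj Y.obj)
      X.property Y.property
  refine ⟨fun X Y ↦ hasBinaryBiproduct_of_total
    { pt := ⟨X.obj ⊞ Y.obj, hP X Y⟩
      fst := ObjectProperty.homMk biprod.fst
      snd := ObjectProperty.homMk biprod.snd
      inl := ObjectProperty.homMk biprod.inl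
      inr := ObjectProperty.homMk biprod.inr
      inl_fst := by ext; simp
      inl_snd := by ext; simp
      inr_fst := by ext; simp
      inr_snd := by ext; simp } ?_⟩
  exact P.hom_ext (biprod.total (X := X.obj) (Y := Y.obj))

theorem biproduct_hom (X Y : P.FullSubcategory) :
    (biprod.inl : X ⟶ X ⊞ Y).hom ≫ (biprod.fst : X ⊞ Y ⟶ X).hom = 𝟙 X.obj ∧
    (biprod.inr : Y ⟶ X ⊞ Y).hom ≫ (biprod.snd : X ⊞ Y ⟶ Y).hom = 𝟙 Y.obj ∧
    (biprod.inl : X ⟶ X ⊞ Y).hom ≫ (biprod.snd : X ⊞ Y ⟶ Y).hom = 0 ∧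
    (biprod.inr : Y ⟶ X ⊞ Y).hom ≫ (biprod.fst : X ⊞ Y ⟶ X).hom = 0 ∧
    (biprod.fst : X ⊞ Y ⟶ X).hom ≫ (biprod.inl : X ⟶ X ⊞ Y).hom +
      (biprod.snd : X ⊞ Y ⟶ Y).hom ≫ (biprod.inr : Y ⟶ X ⊞ Y).hom = 𝟙 (X ⊞ Y).obj :=
  ⟨congrArg (fun f ↦ f.hom) (biprod.inl_fst (X := X) (Y := Y)),
    congrArg (fun f ↦ f.hom) (biprod.inr_snd (X := X) (Y := Y)),
    congrArg (fun f ↦ f.hom) (biprod.inl_snd (X := X) (Y := Y)),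
    congrArg (fun f ↦ f.hom) (biprod.inr_fst (X := X) (Y := Y)),
    congrArg (fun f ↦ f.hom) (biprod.total (X := X) (Y := Y))⟩

/-- The extriangulated structure of an extension-closed subcategory of a triangulated category:
`𝔼(Z, X) = Hom(Z, X⟦1⟧)`, and `δ` is realized by `X ⟶ Y ⟶ Z` if and only if
`X ⟶ Y ⟶ Z ⟶ X⟦1⟧`, with third morphism `δ`, is a distinguished triangle. -/
noncomputable def extensionClosedExtriangulation [IsTriangulated D] :
    Extriangulation.{v} P.FullSubcategory where
  Ext Z X := Z.obj ⟶ X.obj⟦(1 : ℤ)⟧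
  push a :=
    { toFun δ := δ ≫ a.hom⟦(1 : ℤ)⟧'
      map_zero' := by simp
      map_add' := by simp }
  pull c :=
    { toFun δ := c.hom ≫ δ
      map_zero' := by simp
      map_add' := by simp }
  push_id := by simp
  push_comp := by simp
  pull_id := by simp
  pull_comp := by simp
  push_pull := by simp
  push_add {Z X X'} a a' δ := by
    change δ ≫ (a.hom + a'.hom)⟦(1 : ℤ)⟧' = δ ≫ a.hom⟦(1 : ℤ)⟧' + δ ≫ a'.hom⟦(1 : ℤ)⟧'
    rw [Functor.map_add, Preadditive.comp_add]
  pull_add {Z' Z X} c c' δ := by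
    change (c.hom + c'.hom) ≫ δ = c.hom ≫ δ + c'.hom ≫ δ
    rw [Preadditive.add_comp]
  Realizes δ x y := Triangle.mk x.hom y.hom δ ∈ distTriang D
  exists_realizes {X Z} δ := by
    obtain ⟨Y, hY, a, b, h⟩ := P.distinguished_cocone_triangle₂ δ X.property Z.property
    exact ⟨⟨Y, hY⟩, ObjectProperty.homMk a, ObjectProperty.homMk b, h⟩
  realizes_iff := by
    intro X Y Y' Z δ x y x' y' h
    have comm : δ ≫ (𝟙 X.obj)⟦(1 : ℤ)⟧' = 𝟙 Z.obj ≫ δ := by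
      rw [CategoryTheory.Functor.map_id, Category.comp_id, Category.id_comp]
    constructor
    · intro h'
      obtain ⟨(b : Y.obj ⟶ Y'.obj), hb₁, hb₂⟩ :=
        complete_distinguished_triangle_morphism₂ _ _ h h' (𝟙 X.obj) (𝟙 Z.obj) comm
      have iso : IsIso b := isIso₂_of_isIso₁₃
        (Triangle.homMk (Triangle.mk x.hom y.hom δ) (Triangle.mk x'.hom y'.hom δ)
          (𝟙 X.obj) b (𝟙 Z.obj) hb₁ hb₂ comm) h h'
        (inferInstanceAs (IsIso (𝟙 X.obj))) (inferInstanceAs (IsIso (𝟙 Z.obj)))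
      refine ⟨P.isoMk (@asIso _ _ _ _ b iso), ?_, ?_⟩
      · ext
        exact hb₁.trans (Category.id_comp x'.hom)
      · ext
        exact hb₂.symm.trans (Category.comp_id y.hom)
    · rintro ⟨e, he₁, he₂⟩
      refine isomorphic_distinguished _ h _ (Iso.symm (Triangle.isoMk
        (Triangle.mk x.hom y.hom δ) (Triangle.mk x'.hom y'.hom δ) (Iso.refl X.obj)
        (P.ι.mapIso e) (Iso.refl Z.obj) ?_ ?_ comm))
      · exact (congrArg (fun f ↦ f.hom) he₁).trans (Category.id_comp x'.hom).symm
      · exact (Category.comp_id y.hom).trans (congrArg (fun f ↦ f.hom) he₂).symm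
  exists_hom := by
    intro X Y Z X' Y' Z' δ δ' x y x' y' h h' a c hac
    obtain ⟨b, hb₁, hb₂⟩ := complete_distinguished_triangle_morphism₂ _ _ h h' a.hom c.hom hac
    exact ⟨ObjectProperty.homMk b, by ext; exact hb₁, by ext; exact hb₂⟩
  realizes_zero X Z := by
    have hb := biproduct_hom P
    refine distinguished_of_projections (contractible_distinguished X.obj)
      (contractible_distinguished₁ Z.obj)
      (pX := 𝟙 X.obj) (qX := 0) (iX := 𝟙 X.obj) (jX := 0)
      (pY := (biprod.fst : X ⊞ Z ⟶ X).hom) (qY := (biprod.snd : X ⊞ Z ⟶ Z).hom)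
      (iY := (biprod.inl : X ⟶ X ⊞ Z).hom) (jY := (biprod.inr : Z ⟶ X ⊞ Z).hom)
      (pZ := 0) (qZ := 𝟙 Z.obj) (iZ := 0) (jZ := 𝟙 Z.obj)
      (Category.comp_id _) ((isZero_zero D).eq_of_src _ _) comp_zero zero_comp (by simp)
      (hb X Z).1 (hb X Z).2.1 (hb X Z).2.2.1 (hb X Z).2.2.2.1 (hb X Z).2.2.2.2
      ((isZero_zero D).eq_of_src _ _) (Category.comp_id _) zero_comp comp_zero (by simp)
      ?_ ?_ ?_ ?_ ?_ ?_
    · rw [(hb X Z).1, Category.comp_id]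
    · rw [comp_zero, comp_zero]
    · exact zero_comp.trans comp_zero.symm
    · rw [(hb X Z).2.2.1, zero_comp]
    · rfl
    · exact zero_comp.trans comp_zero.symm
  realizes_sum {X Y Z X' Y' Z' δ δ' x y x' y'} h h' := by
    have hb := biproduct_hom P
    refine distinguished_of_projections h h'
      (hb X X').1 (hb X X').2.1 (hb X X').2.2.1 (hb X X').2.2.2.1 (hb X X').2.2.2.2
      (hb Y Y').1 (hb Y Y').2.1 (hb Y Y').2.2.1 (hb Y Y').2.2.2.1 (hb Y Y').2.2.2.2
      (hb Z Z').1 (hb Z Z').2.1 (hb Z Z').2.2.1 (hb Z Z').2.2.2.1 (hb Z Z').2.2.2.2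
      (congrArg (fun f ↦ f.hom) (biprod.map_fst x x'))
      (congrArg (fun f ↦ f.hom) (biprod.map_fst y y')) ?_
      (congrArg (fun f ↦ f.hom) (biprod.map_snd x x'))
      (congrArg (fun f ↦ f.hom) (biprod.map_snd y y')) ?_
    · change (((biprod.fst : Z ⊞ Z' ⟶ Z).hom ≫ δ) ≫ (biprod.inl : X ⟶ X ⊞ X').hom⟦(1 : ℤ)⟧' +
        ((biprod.snd : Z ⊞ Z' ⟶ Z').hom ≫ δ') ≫ (biprod.inr : X' ⟶ X ⊞ X').hom⟦(1 : ℤ)⟧') ≫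
        (biprod.fst : X ⊞ X' ⟶ X).hom⟦(1 : ℤ)⟧' = (biprod.fst : Z ⊞ Z' ⟶ Z).hom ≫ δ
      simp only [Preadditive.add_comp, Category.assoc, ← Functor.map_comp, (hb X X').1,
        (hb X X').2.2.2.1]
      simp
    · change (((biprod.fst : Z ⊞ Z' ⟶ Z).hom ≫ δ) ≫ (biprod.inl : X ⟶ X ⊞ X').hom⟦(1 : ℤ)⟧' +
        ((biprod.snd : Z ⊞ Z' ⟶ Z').hom ≫ δ') ≫ (biprod.inr : X' ⟶ X ⊞ X').hom⟦(1 : ℤ)⟧') ≫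
        (biprod.snd : X ⊞ X' ⟶ X').hom⟦(1 : ℤ)⟧' = (biprod.snd : Z ⊞ Z' ⟶ Z').hom ≫ δ'
      simp only [Preadditive.add_comp, Category.assoc, ← Functor.map_comp, (hb X X').2.1,
        (hb X X').2.2.1]
      simp
  et3 := by
    intro X Y Z X' Y' Z' δ δ' x y x' y' h h' a b hab
    obtain ⟨c, hc₁, hc₂⟩ := complete_distinguished_triangle_morphism _ _ h h' a.hom b.hom
      (congrArg (fun f ↦ f.hom) hab)
    exact ⟨ObjectProperty.homMk c, by ext; exact hc₁, hc₂⟩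
  et3_op := by
    intro X Y Z X' Y' Z' δ δ' x y x' y' h h' b c hbc
    obtain ⟨a, ha₁, ha₂⟩ := complete_distinguished_triangle_morphism₁ _ _ h h' b.hom c.hom
      (congrArg (fun f ↦ f.hom) hbc)
    exact ⟨ObjectProperty.homMk a, by ext; exact ha₁, ha₂⟩
  et4 := by
    intro A B D' K F δ δ' f f' g g' h h'
    obtain ⟨G, k, δ'', h''⟩ := distinguished_cocone_triangle (f.hom ≫ g.hom)
    have O := someOctahedron rfl h h' h''
    have hG : P G := P.ext_of_isTriangulatedClosed₂ _ O.mem D'.property F.property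
    exact ⟨⟨G, hG⟩, ObjectProperty.homMk k, ObjectProperty.homMk O.m₁, ObjectProperty.homMk O.m₃,
      δ'', h'', by ext; exact O.comm₁, by ext; exact O.comm₃, O.mem, O.comm₂, O.comm₄⟩
  et4_op := by
    intro A B D' K F δ δ' f' f g' g h h'
    obtain ⟨G, k, δ'', h''⟩ := distinguished_cocone_triangle₁ (f.hom ≫ g.hom)
    have O := someOctahedron' rfl h h' h''
    have hG : P G := P.ext_of_isTriangulatedClosed₂ _ O.mem D'.property F.property
    exact ⟨⟨G, hG⟩, ObjectProperty.homMk k, ObjectProperty.homMk O.m₁, ObjectProperty.homMk O.m₃,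
      δ'', h'', by ext; exact O.comm₁, by ext; exact O.comm₄.symm, O.mem, O.comm₃, O.comm₂⟩

end Triangulated

/-! ### t-structures -/

section TStructure

variable {D : Type u} [Category.{v} D] [Preadditive D] [HasZeroObject D] [HasShift D ℤ]
  [∀ n : ℤ, (shiftFunctor D n).Additive] [Pretriangulated D]

/-- `Free(W)`: the objects which are coproducts of families of objects of `W`. -/
def Free (W : ObjectProperty D) : ObjectProperty D :=
  fun X ↦ ∃ I : Type t, W.colimitsOfShape (Discrete I) X

/-- The t-structure `(U, W) = (D^{≤ 0}, D^{≥ 0})` is smashing if `W` is closed under coproducts in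
`D`: every family of objects of `W` has a coproduct in `D`, and `Free(W) = W`. The existence of
the coproducts is automatic if `D` has coproducts. -/
def IsSmashing (τ : TStructure D) : Prop :=
  (∀ (I : Type t) (X : I → D), (∀ i, τ.ge 0 (X i)) → HasCoproduct X) ∧
    Free.{t} (τ.ge 0) = τ.ge 0

theorem isSmashing_iff [HasCoproducts.{t} D] (τ : TStructure D) :
    IsSmashing.{t} τ ↔ Free.{t} (τ.ge 0) = τ.ge 0 :=
  ⟨fun h ↦ h.2, fun h ↦ ⟨fun _ _ _ ↦ inferInstance, h⟩⟩

/-- The global dimension `min {k ∈ ℕ | Hom(W, Σ^{k+1} U) = 0}` of the t-structure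
`(U, W) = (D^{≤ 0}, D^{≥ 0})`; it is `∞` if there is no such `k`. -/
noncomputable def globalDimension (τ : TStructure D) : ℕ∞ :=
  sInf {d : ℕ∞ | ∃ k : ℕ, d = k ∧ ∀ ⦃X Y : D⦄, τ.ge 0 X → τ.le 0 Y →
    ∀ f : X ⟶ Y⟦((k + 1 : ℕ) : ℤ)⟧, f = 0}

/-- The extended heart `C_{n+1} = W ∩ Σ^{-n} U` (of length `n + 1`) of the t-structure
`(U, W) = (D^{≤ 0}, D^{≥ 0})`. -/
def extendedHeart (τ : TStructure D) (n : ℕ) : ObjectProperty D :=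
  τ.ge 0 ⊓ (τ.le 0).shift (n : ℤ)

variable (τ : TStructure D) (n : ℕ)

theorem extendedHeart_iff (X : D) : extendedHeart τ n X ↔ τ.IsGE X 0 ∧ τ.IsLE X n := by
  rw [extendedHeart, τ.shift_le n 0 n (by simp)]
  simp

instance : (extendedHeart τ n).IsClosedUnderIsomorphisms where
  of_iso e h := by
    rw [extendedHeart_iff] at h ⊢
    have := h.1
    have := h.2
    exact ⟨τ.isGE_of_iso e 0, τ.isLE_of_iso e n⟩

instance : (extendedHeart τ n).ContainsZero where
  exists_zero := by
    obtain ⟨Z, hZ⟩ := HasZeroObject.zero (C := D)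
    exact ⟨Z, hZ, (extendedHeart_iff τ n Z).2 ⟨τ.isGE_of_isZero hZ 0, τ.isLE_of_isZero hZ n⟩⟩

instance : (extendedHeart τ n).IsTriangulatedClosed₂ := .mk' (fun T hT h₁ h₃ ↦ by
  rw [extendedHeart_iff] at h₁ h₃ ⊢
  exact ⟨τ.isGE₂ T hT 0 h₁.1 h₃.1, τ.isLE₂ T hT n h₁.2 h₃.2⟩)

/-- The extended heart `C_{n+1}` as an extriangulated category. -/
noncomputable def extendedHeartExtriangulation [IsTriangulated D] :
    Extriangulation.{v} (extendedHeart τ n).FullSubcategory :=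
  extensionClosedExtriangulation (extendedHeart τ n)

end TStructure

end AET

/-! The conditions are linked by exactness of coproducts in `A` (AB4: coproducts of monomorphisms
are monomorphisms), through the cycle smashing ⇒ AET4 ⇒ AET3.5 ⇒ AB4 ⇒ smashing.

If the t-structure is smashing, the extended heart is closed under coproducts of `D(A)`, since `D^{≤
n}` is a left orthogonal and so contains every coproduct of its objects that exists. The universal
property of `∐ Zᵢ` then forces the choice of `Γ`, and a coproduct of distinguished triangles is
distinguished (`distinguished_of_isColimit`); this gives `extensionClosed_isAET4`.

Given AET3.5, monomorphisms `xᵢ : X ⟶ Yᵢ` of `A` and their cokernels give triangles in the extended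
heart. Their coproduct is a triangle whose first two terms are computed in `A`
(`toExtendedHeartIsColimit`) and whose third lies in `D^{≥ 0}`, so its `H^{-1}` vanishes and `∐ xᵢ`
is a monomorphism. A pushout argument removes the common source (`mono_sigmaMap_of_isAET35`).

Under AB4, degreewise coproducts of complexes preserve quasi-isomorphisms, hence compute coproducts
in `D(A)` (`nonempty_isColimit_Q_coproductComplex`), and they visibly preserve complexes vanishing
in negative degrees. -/

namespace AET

/-! ### Coproducts of distinguished triangles -/

section CoproductTriangles

variable {D : Type u} [Category.{v} D] [Preadditive D] [HasZeroObject D] [HasShift D ℤ]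
  [∀ n : ℤ, (shiftFunctor D n).Additive] [Pretriangulated D]

/-- A triangle which is, objectwise, a coproduct of distinguished triangles is distinguished. -/
theorem distinguished_of_isColimit {I : Type*} (T : I → Triangle D) (hT : ∀ i, T i ∈ distTriang D)
    (T' : Triangle D) (φ : ∀ i, T i ⟶ T')
    (h₁ : IsColimit (Cofan.mk T'.obj₁ fun i ↦ (φ i).hom₁))
    (h₂ : IsColimit (Cofan.mk T'.obj₂ fun i ↦ (φ i).hom₂))
    (h₃ : IsColimit (Cofan.mk T'.obj₃ fun i ↦ (φ i).hom₃)) :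
    T' ∈ distTriang D := by
  have ext₂ {W : D} (f g : T'.obj₂ ⟶ W) (h : ∀ i, (φ i).hom₂ ≫ f = (φ i).hom₂ ≫ g) : f = g :=
    Cofan.IsColimit.hom_ext h₂ _ _ h
  have ext₃ {W : D} (f g : T'.obj₃ ⟶ W) (h : ∀ i, (φ i).hom₃ ≫ f = (φ i).hom₃ ≫ g) : f = g :=
    Cofan.IsColimit.hom_ext h₃ _ _ h
  have ext₁ {W : D} (f g : T'.obj₁ ⟶ W) (h : ∀ i, (φ i).hom₁ ≫ f = (φ i).hom₁ ≫ g) : f = g :=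
    Cofan.IsColimit.hom_ext h₁ _ _ h
  have shift₁ {W : D} (f : ∀ i, (T i).obj₁⟦(1 : ℤ)⟧ ⟶ W) :
      ∃ g : T'.obj₁⟦(1 : ℤ)⟧ ⟶ W, ∀ i, (φ i).hom₁⟦(1 : ℤ)⟧' ≫ g = f i := by
    have H := isColimitCofanMkObjOfIsColimit (shiftFunctor D (1 : ℤ)) _ _ h₁
    exact ⟨Cofan.IsColimit.desc H f, fun i ↦ Cofan.IsColimit.fac H f i⟩
  have shift₂ {W : D} (f : ∀ i, (T i).obj₂⟦(1 : ℤ)⟧ ⟶ W) :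
      ∃ g : T'.obj₂⟦(1 : ℤ)⟧ ⟶ W, ∀ i, (φ i).hom₂⟦(1 : ℤ)⟧' ≫ g = f i := by
    have H := isColimitCofanMkObjOfIsColimit (shiftFunctor D (1 : ℤ)) _ _ h₂
    exact ⟨Cofan.IsColimit.desc H f, fun i ↦ Cofan.IsColimit.fac H f i⟩
  have shiftExt {W : D} (f g : T'.obj₁⟦(1 : ℤ)⟧ ⟶ W)
      (h : ∀ i, (φ i).hom₁⟦(1 : ℤ)⟧' ≫ f = (φ i).hom₁⟦(1 : ℤ)⟧' ≫ g) : f = g :=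
    Cofan.IsColimit.hom_ext
      (isColimitCofanMkObjOfIsColimit (shiftFunctor D (1 : ℤ)) _ _ h₁) _ _ h
  -- Compare `T'` with the cone `Z` of its first morphism. The map `f : T'.obj₃ ⟶ Z` is an
  -- isomorphism by a five lemma argument for `Hom(-, W)`: `T'` is not yet known to be
  -- distinguished, but exactness can be checked on each `T i` and reassembled.
  obtain ⟨Z, y, δ, hZ⟩ := distinguished_cocone_triangle T'.mor₁
  have hc (i : I) : ∃ c : (T i).obj₃ ⟶ Z, (T i).mor₂ ≫ c = (φ i).hom₂ ≫ y ∧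
      (T i).mor₃ ≫ (φ i).hom₁⟦1⟧' = c ≫ δ :=
    complete_distinguished_triangle_morphism _ _ (hT i) hZ _ _ (φ i).comm₁
  choose c hc₂ hc₃ using hc
  obtain ⟨f, hf⟩ : ∃ f : T'.obj₃ ⟶ Z, ∀ i, (φ i).hom₃ ≫ f = c i :=
    ⟨Cofan.IsColimit.desc h₃ c, Cofan.IsColimit.fac h₃ c⟩
  have f₂ : T'.mor₂ ≫ f = y := ext₂ _ _ fun i ↦ by
    rw [← TriangleMorphism.comm₂_assoc, hf, hc₂]
  have f₃ : f ≫ δ = T'.mor₃ := ext₃ _ _ fun i ↦ by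
    rw [reassoc_of% hf i, ← hc₃, (φ i).comm₃]
  have zero₁₂ : T'.mor₁ ≫ T'.mor₂ = 0 := ext₁ _ _ fun i ↦ by
    rw [← TriangleMorphism.comm₁_assoc, ← TriangleMorphism.comm₂,
      comp_distTriang_mor_zero₁₂_assoc _ (hT i), zero_comp, comp_zero]
  have inj {W : D} (g : Z ⟶ W) (hg : f ≫ g = 0) : g = 0 := by
    have hyg : y ≫ g = 0 := by rw [← f₂, assoc, hg, comp_zero]
    obtain ⟨(h : T'.obj₁⟦(1 : ℤ)⟧ ⟶ W), (rfl : g = δ ≫ h)⟩ := Triangle.yoneda_exact₃ _ hZ g hyg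
    have hk (i : I) : ∃ k : (T i).obj₂⟦(1 : ℤ)⟧ ⟶ W,
        (φ i).hom₁⟦(1 : ℤ)⟧' ≫ h = (T i).mor₁⟦(1 : ℤ)⟧' ≫ k := by
      have hz : (T i).mor₃ ≫ (φ i).hom₁⟦(1 : ℤ)⟧' ≫ h = 0 := by
        rw [(φ i).comm₃_assoc, ← f₃, assoc, hg, comp_zero]
      obtain ⟨(k : (T i).obj₂⟦(1 : ℤ)⟧ ⟶ W),
        (hk : _ = (-(T i).mor₁⟦(1 : ℤ)⟧') ≫ k)⟩ :=
        Triangle.yoneda_exact₃ _ (rot_of_distTriang _ (hT i)) _ hz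
      -- The sign comes from rotating the triangle.
      exact ⟨-k, by rw [hk, Preadditive.neg_comp, Preadditive.comp_neg]⟩
    choose k hk using hk
    obtain ⟨k', hk'⟩ := shift₂ k
    have : h = T'.mor₁⟦(1 : ℤ)⟧' ≫ k' := shiftExt _ _ fun i ↦ by
      rw [hk, ← hk', ← Functor.map_comp_assoc, ← Functor.map_comp_assoc, (φ i).comm₁]
    rw [this]
    exact (comp_distTriang_mor_zero₃₁_assoc _ hZ k').trans zero_comp
  -- Extend `T'.mor₂ ≫ g` along `y` to `g₀`. The error `g - f ≫ g₀` vanishes on `T'.mor₂`, hence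
  -- factors through `T'.mor₃ = f ≫ δ` and can be absorbed by correcting `g₀`.
  have surj {W : D} (g : T'.obj₃ ⟶ W) : ∃ g' : Z ⟶ W, f ≫ g' = g := by
    obtain ⟨(g₀ : Z ⟶ W), (hg₀ : T'.mor₂ ≫ g = y ≫ g₀)⟩ :=
      Triangle.yoneda_exact₂ _ hZ (T'.mor₂ ≫ g)
        ((reassoc_of% zero₁₂) g |>.trans zero_comp)
    have hh (i : I) : ∃ h : (T i).obj₁⟦(1 : ℤ)⟧ ⟶ W,
        (φ i).hom₃ ≫ (g - f ≫ g₀) = (T i).mor₃ ≫ h := by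
      refine Triangle.yoneda_exact₃ _ (hT i) _ ?_
      rw [(φ i).comm₂_assoc, Preadditive.comp_sub, hg₀, reassoc_of% f₂, sub_self, comp_zero]
    choose h hh using hh
    obtain ⟨h', hh'⟩ := shift₁ h
    refine ⟨g₀ + δ ≫ h', ?_⟩
    have : g - f ≫ g₀ = T'.mor₃ ≫ h' := ext₃ _ _ fun i ↦ by
      rw [hh, ← hh', (φ i).comm₃_assoc]
    rw [Preadditive.comp_add, reassoc_of% f₃, ← this, add_sub_cancel]
  -- By `surj` the map `f` is a split monomorphism, and by `inj` it is an epimorphism.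
  have : IsIso f := by
    obtain ⟨r, hr⟩ := surj (𝟙 _)
    refine ⟨r, hr, ?_⟩
    rw [← sub_eq_zero]
    apply inj
    rw [Preadditive.comp_sub, reassoc_of% hr, comp_id, sub_self]
  let e : T'.obj₃ ≅ Z := asIso f
  exact isomorphic_distinguished _ hZ _
    (Triangle.isoMk _ (Triangle.mk T'.mor₁ y δ) (Iso.refl _) (Iso.refl _) e
      ((comp_id T'.mor₁).trans (id_comp T'.mor₁).symm) (f₂.trans (id_comp y).symm)
      (by
        change T'.mor₃ ≫ (shiftFunctor D (1 : ℤ)).map (𝟙 T'.obj₁) = f ≫ δ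
        rw [CategoryTheory.Functor.map_id, comp_id, f₃]))

end CoproductTriangles

/-- If the coproduct in the ambient category of a family of objects satisfying `P` exists and
satisfies `P`, then it is also a coproduct in the full subcategory. -/
theorem fullSubcategory_hasCoproduct {D : Type u} [Category.{v} D]
    (P : ObjectProperty D) {I : Type*}
    (X : I → P.FullSubcategory)
    [HasCoproduct fun i ↦ (X i).obj] (hX : P (∐ fun i ↦ (X i).obj)) :
    HasCoproduct X ∧ PreservesColimit (Discrete.functor X) P.ι := by
  let c : Cofan X := Cofan.mk ⟨_, hX⟩ fun i ↦
    ObjectProperty.homMk (Sigma.ι (fun i ↦ (X i).obj) i)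
  have hc' : IsColimit (Cofan.mk (P.ι.obj c.pt) fun i ↦ P.ι.map (c.inj i)) :=
    coproductIsCoproduct fun i ↦ (X i).obj
  have hc : IsColimit c := isColimitOfIsColimitCofanMkObj P.ι X _ hc'
  exact ⟨⟨⟨c, hc⟩⟩, preservesColimit_of_preserves_colimit_cocone hc
    ((isColimitMapCoconeCofanMkEquiv P.ι X c.inj).symm hc')⟩

/-! ### From smashing to AET4 -/

section ClosedUnderCoproducts

variable {D : Type u} [Category.{v} D] [Preadditive D] [HasZeroObject D] [HasShift D ℤ]
  [∀ n : ℤ, (shiftFunctor D n).Additive] [Pretriangulated D]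

/-- An extension-closed subcategory which is closed under coproducts of the ambient triangulated
category satisfies AET4. -/
theorem extensionClosed_isAET4 [IsTriangulated D] (P : ObjectProperty D) [P.ContainsZero]
    [P.IsClosedUnderIsomorphisms] [P.IsTriangulatedClosed₂]
    (hP : ∀ (I : Type t) (X : I → D), (∀ i, P (X i)) → ∃ _ : HasCoproduct X, P (∐ X)) :
    (extensionClosedExtriangulation P).IsAET4.{t} := by
  intro I _
  have key (X : I → P.FullSubcategory) :
      HasCoproduct X ∧ PreservesColimit (Discrete.functor X) P.ι := by
    obtain ⟨_, h⟩ := hP I (fun i ↦ (X i).obj) fun i ↦ (X i).property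
    exact fullSubcategory_hasCoproduct P X h
  have : HasCoproductsOfShape I P.FullSubcategory :=
    ⟨fun F ↦ have : HasColimit _ := (key (F.obj ∘ Discrete.mk)).1
      hasColimit_of_iso Discrete.natIsoFunctor⟩
  have hι (X : I → P.FullSubcategory) :
      IsColimit (Cofan.mk (∐ X).obj fun i ↦ (Sigma.ι X i).hom) :=
    have := (key X).2
    isColimitOfHasCoproductOfPreservesColimit P.ι X
  have ext {X : I → P.FullSubcategory} {W : D} (f g : (∐ X).obj ⟶ W)
      (h : ∀ i, (Sigma.ι X i).hom ≫ f = (Sigma.ι X i).hom ≫ g) : f = g :=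
    Cofan.IsColimit.hom_ext (hι X) _ _ h
  have map_hom {X Y : I → P.FullSubcategory} (f : ∀ i, X i ⟶ Y i) (i : I) :
      (Sigma.ι X i).hom ≫ (Limits.Sigma.map f).hom = (f i).hom ≫ (Sigma.ι Y i).hom :=
    congrArg (fun f ↦ f.hom) (Sigma.ι_map f i)
  -- The AET4 identity `μᵢ · ηᵢ = Γ(η) · μᵢ` determines `Γ`, because `∐ Z` is also a coproduct in
  -- `D`; it is taken as the definition.
  let γ (Z : I → P.FullSubcategory) (X : P.FullSubcategory)
      (η : ∀ i, (Z i).obj ⟶ X.obj⟦(1 : ℤ)⟧) : (∐ Z).obj ⟶ (∐ fun _ : I ↦ X).obj⟦(1 : ℤ)⟧ :=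
    Cofan.IsColimit.desc (hι Z) fun i ↦ η i ≫ (Sigma.ι (fun _ : I ↦ X) i).hom⟦1⟧'
  have hγ (Z : I → P.FullSubcategory) (X : P.FullSubcategory)
      (η : ∀ i, (Z i).obj ⟶ X.obj⟦(1 : ℤ)⟧) (i : I) :
      (Sigma.ι Z i).hom ≫ γ Z X η = η i ≫ (Sigma.ι (fun _ : I ↦ X) i).hom⟦1⟧' :=
    Cofan.IsColimit.fac (hι Z) _ i
  refine ⟨this, ⟨fun Z X ↦ AddMonoidHom.mk' (γ Z X) ?_, ?_, ?_⟩, ?_⟩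
  · intro η η'
    refine ext _ _ fun i ↦ (hγ _ _ _ i).trans ((Preadditive.add_comp _ _ _ _ _ _).trans ?_)
    exact (((Preadditive.comp_add _ _ _ _ _ _).trans
      (congrArg₂ _ (hγ Z X η i) (hγ Z X η' i)))).symm
  · intro Z Z' X X' c a (η : ∀ i, (Z i).obj ⟶ X.obj⟦(1 : ℤ)⟧)
    refine ext _ _ fun i ↦ (hγ _ _ _ i).trans ?_
    change (((c i).hom ≫ η i) ≫ a.hom⟦(1 : ℤ)⟧') ≫ (Sigma.ι (fun _ : I ↦ X') i).hom⟦(1 : ℤ)⟧' =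
      (Sigma.ι Z' i).hom ≫ ((Limits.Sigma.map c).hom ≫ γ Z X η) ≫
        (Limits.Sigma.map fun _ : I ↦ a).hom⟦(1 : ℤ)⟧'
    rw [assoc, assoc, assoc, reassoc_of% map_hom c i, reassoc_of% hγ Z X η i, ← Functor.map_comp,
      ← Functor.map_comp, map_hom]
  · intro Z X η Y x y h
    refine distinguished_of_isColimit (fun i ↦ Triangle.mk (x i).hom (y i).hom (η i)) h
      (Triangle.mk (Limits.Sigma.map x).hom (Limits.Sigma.map y).hom (γ Z X η))
      (fun i ↦ Triangle.homMk _ _ (Sigma.ι (fun _ : I ↦ X) i).hom (Sigma.ι Y i).hom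
        (Sigma.ι Z i).hom (map_hom x i).symm (map_hom y i).symm (hγ Z X η i).symm)
      (hι _) (hι _) (hι _)
  · exact fun Z X η i ↦ (hγ Z X η i).symm

theorem IsSmashing.ge_coproduct {τ : TStructure D} (hτ : IsSmashing.{t} τ) {I : Type t}
    (X : I → D) (hX : ∀ i, τ.ge 0 (X i)) : ∃ _ : HasCoproduct X, τ.ge 0 (∐ X) := by
  have := hτ.1 I X hX
  refine ⟨this, hτ.2.le _ ⟨I, ⟨ObjectProperty.ColimitOfShape.colimit (Discrete.functor X) ?_⟩⟩⟩
  exact fun i ↦ hX i.as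

/-- The extended hearts of a smashing t-structure satisfy AET4. -/
theorem IsSmashing.isAET4 [IsTriangulated D] {τ : TStructure D} (hτ : IsSmashing.{t} τ) (n : ℕ) :
    (extendedHeartExtriangulation τ n).IsAET4.{t} := by
  refine extensionClosed_isAET4 _ fun I X hX ↦ ?_
  simp only [extendedHeart_iff] at hX ⊢
  obtain ⟨h, hge⟩ := hτ.ge_coproduct X fun i ↦ (hX i).1.ge
  -- The bound `≤ n` needs no smashing: it is left orthogonality to `D^{≥ n+1}`, which can be tested
  -- on the coproduct inclusions.
  refine ⟨h, ⟨hge⟩, (τ.isLE_iff_orthogonal _ _ rfl _).2 fun Y f _ ↦ ?_⟩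
  refine Limits.Sigma.hom_ext _ _ fun i ↦ ?_
  have := (hX i).2
  rw [comp_zero]
  exact τ.zero _ n (n + 1)

end ClosedUnderCoproducts

theorem Extriangulation.IsAET4.isAET35 {C : Type u} [Category.{v} C] [Preadditive C]
    [HasZeroObject C] [HasBinaryBiproducts C] {E : Extriangulation.{w} C} (h : E.IsAET4.{t}) :
    E.IsAET35.{t} :=
  fun I _ ↦ have ⟨h₁, S, _⟩ := h I; ⟨h₁, ⟨S⟩⟩

/-! ### From AET3.5 to exactness of coproducts in the abelian category -/

section Heart

open DerivedCategory

variable {A : Type u} [Category.{v} A] [Abelian A] [HasDerivedCategory.{w} A]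

/-- Morphisms from an object `X` of the abelian category to an object `W` of `D^{≥ 0}` factor
uniquely through an object of the abelian category, which does not depend on `X`. -/
theorem exists_singleFunctor_coreflection (W : DerivedCategory A)
    (hW : (TStructure.t : TStructure (DerivedCategory A)).IsGE W 0) :
    ∃ (H : A) (p : (singleFunctor A 0).obj H ⟶ W),
      ∀ ⦃X : A⦄ (f : (singleFunctor A 0).obj X ⟶ W), ∃! g : X ⟶ H,
        (singleFunctor A 0).map g ≫ p = f := by
  -- As `W` lies in `D^{≥ 0}`, its truncation `τ^{≤ 0} W` lies in the heart; objects of `D^{≤ 0}`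
  -- map to `W` uniquely through it.
  obtain ⟨H, ⟨e⟩⟩ := exists_iso_singleFunctor_obj_of_isGE_of_isLE
    ((TStructure.t.truncLE 0).obj W) 0
  refine ⟨H, e.inv ≫ (TStructure.t.truncLEι 0).app W, fun X f ↦ ?_⟩
  obtain ⟨g, hg⟩ := (singleFunctor A 0).map_surjective (TStructure.t.liftTruncLE f 0 ≫ e.hom)
  refine ⟨g, by simp [hg], fun g' hg' ↦ (singleFunctor A 0).map_injective ?_⟩
  rw [hg, ← cancel_mono e.inv, assoc, e.hom_inv_id, comp_id]
  apply TStructure.t.to_truncLE_obj_ext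
  simpa using hg'

variable (A) in
/-- The inclusion of the abelian category into the extended heart of the standard t-structure. -/
noncomputable def toExtendedHeart (n : ℕ) :
    A ⥤ (extendedHeart (TStructure.t : TStructure (DerivedCategory A)) n).FullSubcategory :=
  ObjectProperty.lift _ (singleFunctor A 0) fun X ↦ (extendedHeart_iff _ n _).2
    ⟨inferInstance, TStructure.t.isLE_of_le _ 0 n⟩

/-- The inclusion of the abelian category into the extended heart preserves coproducts. -/
noncomputable def toExtendedHeartIsColimit (n : ℕ) {I : Type*} (X : I → A) [HasCoproduct X] :
    IsColimit (Cofan.mk ((toExtendedHeart A n).obj (∐ X)) fun i ↦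
      (toExtendedHeart A n).map (Sigma.ι X i)) := by
  -- The coreflection turns maps into `W` into maps into an object of `A`, where the universal
  -- property of `∐ X` applies.
  have key (W : (extendedHeart (TStructure.t : TStructure (DerivedCategory A)) n).FullSubcategory)
      (f : ∀ i, (singleFunctor A 0).obj (X i) ⟶ W.obj) :
      ∃! g : (singleFunctor A 0).obj (∐ X) ⟶ W.obj,
        ∀ i, (singleFunctor A 0).map (Sigma.ι X i) ≫ g = f i := by
    obtain ⟨H, p, hp⟩ := exists_singleFunctor_coreflection W.obj
      ((extendedHeart_iff _ n _).1 W.property).1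
    choose g hg _ using fun i ↦ hp (f i)
    refine ⟨(singleFunctor A 0).map (Sigma.desc g) ≫ p, fun i ↦ ?_, fun g' hg' ↦ ?_⟩
    · rw [← Functor.map_comp_assoc, Sigma.ι_desc]
      exact hg i
    · obtain ⟨k, rfl, -⟩ := hp g'
      congr 2
      refine Sigma.hom_ext _ _ fun i ↦ (hp (f i)).unique ?_ ?_
      · rw [← hg' i, Functor.map_comp_assoc]
      · rw [Sigma.ι_desc]
        exact hg i
  refine Cofan.IsColimit.mk _
    (fun s ↦ ObjectProperty.homMk (key s.pt fun i ↦ (s.inj i).hom).choose) (fun s i ↦ ?_)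
    fun s m hm ↦ ?_
  · ext
    exact (key s.pt fun i ↦ (s.inj i).hom).choose_spec.1 i
  · ext
    exact (key s.pt fun i ↦ (s.inj i).hom).choose_spec.2 m.hom fun i ↦
      congrArg (fun f ↦ f.hom) (hm i)

/-- A morphism of the abelian category which is the first morphism of a distinguished triangle
with third object in `D^{≥ 0}` is a monomorphism. -/
theorem mono_of_distinguished {X Y : A} (f : X ⟶ Y)
    (T : Triangle (DerivedCategory A)) (hT : T ∈ distTriang (DerivedCategory A))
    (h₃ : (TStructure.t : TStructure (DerivedCategory A)).IsGE T.obj₃ 0)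
    (e : Arrow.mk ((singleFunctor A 0).map f) ≅ Arrow.mk T.mor₁) : Mono f := by
  -- The long exact homology sequence, with `H^{-1}` of the third object zero.
  have h₁ : Mono ((homologyFunctor A 0).map T.mor₁) := by
    rw [HomologySequence.mono_homologyMap_mor₁_iff T hT (-1) 0]
    exact (DerivedCategory.isZero_of_isGE T.obj₃ 0 (-1) (by lia)).eq_of_src _ _
  have h₂ : Mono ((homologyFunctor A 0).map ((singleFunctor A 0).map f)) :=
    ((MorphismProperty.monomorphisms A).arrow_mk_iso_iff
      ((homologyFunctor A 0).mapArrow.mapIso e)).2 h₁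
  exact ((MorphismProperty.monomorphisms A).arrow_mk_iso_iff
    (((Functor.mapArrowFunctor _ _).mapIso (singleFunctorCompHomologyFunctorIso A 0)).app
      (Arrow.mk f))).1 h₂

/-- If an extended heart of the standard t-structure satisfies AET3.5, then coproducts of
monomorphisms with the same source are monomorphisms. -/
theorem mono_sigmaMap_of_isAET35_of_const [HasCoproducts.{t} A] (n : ℕ)
    (h : (extendedHeartExtriangulation
      (TStructure.t : TStructure (DerivedCategory A)) n).IsAET35.{t})
    {I : Type t} [Nonempty I] {X : A} {Y : I → A} (x : ∀ i, X ⟶ Y i) [∀ i, Mono (x i)] :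
    Mono (Limits.Sigma.map x) := by
  obtain ⟨_, ⟨S⟩⟩ := h I
  have hS (i : I) : (ShortComplex.mk (x i) (cokernel.π (x i)) (cokernel.condition _)).ShortExact :=
    { exact := ShortComplex.exact_cokernel _ }
  let J := toExtendedHeart A n
  -- The extension class of each short exact sequence is its connecting morphism `singleδ`.
  have hd := S.realizes (Z := fun i ↦ J.obj (cokernel (x i))) (X := J.obj X)
    (fun i ↦ (hS i).singleδ) (fun i ↦ J.obj (Y i)) (fun i ↦ J.map (x i))
    (fun i ↦ J.map (cokernel.π (x i))) (fun i ↦ (hS i).singleTriangle_distinguished)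
  let e (X : I → A) : J.obj (∐ X) ≅ ∐ fun i ↦ J.obj (X i) :=
    (toExtendedHeartIsColimit n X).coconePointUniqueUpToIso
      (coproductIsCoproduct fun i ↦ J.obj (X i))
  have he (X : I → A) (i : I) : J.map (Sigma.ι X i) ≫ (e X).hom = Sigma.ι (fun i ↦ J.obj (X i)) i :=
    (toExtendedHeartIsColimit n X).comp_coconePointUniqueUpToIso_hom _ ⟨i⟩
  have comm : (e fun _ ↦ X).hom ≫ Limits.Sigma.map (fun i ↦ J.map (x i)) =
      J.map (Limits.Sigma.map x) ≫ (e Y).hom := by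
    refine Cofan.IsColimit.hom_ext (toExtendedHeartIsColimit n _) _ _ fun i ↦ ?_
    change J.map (Sigma.ι (fun _ : I ↦ X) i) ≫ _ = J.map (Sigma.ι (fun _ : I ↦ X) i) ≫ _
    rw [reassoc_of% he (fun _ ↦ X) i, Sigma.ι_map, ← Functor.map_comp_assoc, Sigma.ι_map,
      Functor.map_comp_assoc, he Y i]
  exact mono_of_distinguished _ _ hd
    ((extendedHeart_iff _ n _).1 (∐ fun i ↦ J.obj (cokernel (x i))).property).1
    (Arrow.isoMk ((ObjectProperty.ι _).mapIso (e fun _ ↦ X)) ((ObjectProperty.ι _).mapIso (e Y))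
      (congrArg (fun f ↦ f.hom) comm))

/-- If an extended heart of the standard t-structure satisfies AET3.5, then coproducts of
monomorphisms are monomorphisms. -/
theorem mono_sigmaMap_of_isAET35 [HasCoproducts.{t} A] (n : ℕ)
    (h : (extendedHeartExtriangulation
      (TStructure.t : TStructure (DerivedCategory A)) n).IsAET35.{t})
    {I : Type t} {X Y : I → A} (f : ∀ i, X i ⟶ Y i) [∀ i, Mono (f i)] :
    Mono (Limits.Sigma.map f) := by
  -- AET3.5 concerns only non-empty index sets.
  obtain _ | _ := isEmpty_or_nonempty I
  · have hX : IsZero (∐ X) := (IsZero.iff_id_eq_zero _).2 (Sigma.hom_ext _ _ isEmptyElim)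
    exact ⟨fun a b _ ↦ hX.eq_of_tgt a b⟩
  -- Pushing out each `f i` along `X i ⟶ ∐ X` gives monomorphisms with the common source `∐ X`.
  have := mono_sigmaMap_of_isAET35_of_const n h
    fun i ↦ (pushout.inr (f i) (Sigma.ι X i) : ∐ X ⟶ _)
  have comm : Limits.Sigma.map f ≫ Limits.Sigma.map (fun i ↦ pushout.inl (f i) (Sigma.ι X i)) =
      Limits.Sigma.map (fun i ↦ Sigma.ι X i) ≫
        Limits.Sigma.map (fun i ↦ pushout.inr (f i) (Sigma.ι X i)) := by
    refine Sigma.hom_ext _ _ fun i ↦ ?_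
    simp [pushout.condition_assoc]
  -- Split by the codiagonal.
  have : Mono (Limits.Sigma.map (fun i ↦ Sigma.ι X i)) := by
    have h : Limits.Sigma.map (fun i ↦ Sigma.ι X i) ≫ Sigma.desc
        (fun _ ↦ 𝟙 (∐ X)) = 𝟙 (∐ X) :=
      Sigma.hom_ext _ _ fun i ↦ by simp
    exact mono_of_mono_fac h
  exact mono_of_mono_fac comm

end Heart

/-! ### Exact coproducts and degreewise coproducts of complexes -/

section Coproducts

variable {A : Type u} [Category.{v} A] [Abelian A] {I : Type t} [HasColimitsOfShape (Discrete I) A]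

instance colim_additive : (colim : (Discrete I ⥤ A) ⥤ A).Additive :=
  have := preservesBinaryBiproducts_of_preservesBinaryCoproducts (colim : (Discrete I ⥤ A) ⥤ A)
  Functor.additive_of_preservesBinaryBiproducts _

/-- If coproducts indexed by `I` preserve monomorphisms, then they are exact. -/
theorem colim_preservesHomology
    (hA : ∀ (X Y : I → A) (f : ∀ i, X i ⟶ Y i) [∀ i, Mono (f i)], Mono (Limits.Sigma.map f)) :
    (colim : (Discrete I ⥤ A) ⥤ A).PreservesHomology := by
  -- Being a left adjoint, `colim` is right exact, so only preservation of the monomorphism in a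
  -- short exact sequence is at stake.
  suffices h : ∀ S : ShortComplex (Discrete I ⥤ A), S.ShortExact →
      (S.map (colim : (Discrete I ⥤ A) ⥤ A)).ShortExact from
    ((colim : (Discrete I ⥤ A) ⥤ A).exact_tfae.out 0 2).1 h
  intro S hS
  obtain ⟨h₁, h₂⟩ := (Functor.preservesFiniteColimits_iff_forall_exact_map_and_epi
    (colim : (Discrete I ⥤ A) ⥤ A)).1 inferInstance S hS
  have := hS.mono_f
  have h₃ := hA _ _ fun i ↦ S.f.app ⟨i⟩
  refine { exact := h₁, epi_g := h₂, mono_f := ?_ }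
  refine ((MorphismProperty.monomorphisms A).arrow_mk_iso_iff
    ((colim : (Discrete I ⥤ A) ⥤ A).mapArrow.mapIso
      (Arrow.isoMk (f := Arrow.mk S.f)
        (g := Arrow.mk (Discrete.natTrans fun i ↦ S.f.app ⟨i.as⟩ :
          Discrete.functor (fun i ↦ S.X₁.obj ⟨i⟩) ⟶ Discrete.functor (fun i ↦ S.X₂.obj ⟨i⟩)))
        Discrete.natIsoFunctor Discrete.natIsoFunctor ?_))).2 h₃
  ext ⟨i⟩
  simp [Discrete.natIsoFunctor]

/-- A family of complexes, as a complex of families. -/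
abbrev familyComplex (K : I → CochainComplex A ℤ) : CochainComplex (Discrete I ⥤ A) ℤ where
  X n := Discrete.functor fun i ↦ (K i).X n
  d m n := Discrete.natTrans fun i ↦ (K i.as).d m n
  shape m n h := by
    ext i
    exact (K i.as).shape m n h

/-- A family of morphisms of complexes, as a morphism of complexes of families. -/
@[simps]
def familyComplexMap {K L : I → CochainComplex A ℤ} (f : ∀ i, K i ⟶ L i) :
    familyComplex K ⟶ familyComplex L where
  f n := Discrete.natTrans fun i ↦ (f i.as).f n

/-- The degreewise coproduct of a family of complexes. -/
noncomputable abbrev coproductComplex (K : I → CochainComplex A ℤ) : CochainComplex A ℤ where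
  X n := ∐ fun i ↦ (K i).X n
  d m n := Limits.Sigma.map fun i ↦ (K i).d m n
  shape m n h := Limits.Sigma.hom_ext _ _ fun i ↦ by
    rw [Limits.Sigma.ι_map, (K i).shape m n h, zero_comp, comp_zero]

/-- The inclusions into the degreewise coproduct. -/
@[simps]
noncomputable def coproductComplexι (K : I → CochainComplex A ℤ) (i : I) :
    K i ⟶ coproductComplex K where
  f n := Limits.Sigma.ι (fun i ↦ (K i).X n) i

/-- The morphism from the degreewise coproduct induced by a family of morphisms. -/
@[simps]
noncomputable def coproductComplexDesc {K : I → CochainComplex A ℤ} {L : CochainComplex A ℤ}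
    (f : ∀ i, K i ⟶ L) : coproductComplex K ⟶ L where
  f n := Limits.Sigma.desc fun i ↦ (f i).f n

/-- The functoriality of degreewise coproducts. -/
@[simps]
noncomputable def coproductComplexMap {K L : I → CochainComplex A ℤ} (f : ∀ i, K i ⟶ L i) :
    coproductComplex K ⟶ coproductComplex L where
  f n := Limits.Sigma.map fun i ↦ (f i).f n

theorem coproductComplexι_desc {K : I → CochainComplex A ℤ} {L : CochainComplex A ℤ}
    (f : ∀ i, K i ⟶ L) (i : I) : coproductComplexι K i ≫ coproductComplexDesc f = f i := by
  ext n
  simp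

theorem coproductComplexι_map {K L : I → CochainComplex A ℤ} (f : ∀ i, K i ⟶ L i) (i : I) :
    coproductComplexι K i ≫ coproductComplexMap f = f i ≫ coproductComplexι L i := by
  ext n
  simp

/-- If coproducts preserve monomorphisms, then coproducts of quasi-isomorphisms are
quasi-isomorphisms. -/
theorem quasiIso_coproductComplexMap
    (hA : ∀ (X Y : I → A) (f : ∀ i, X i ⟶ Y i) [∀ i, Mono (f i)], Mono (Limits.Sigma.map f))
    {K L : I → CochainComplex A ℤ} (f : ∀ i, K i ⟶ L i) (hf : ∀ i, QuasiIso (f i)) :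
    QuasiIso (coproductComplexMap f) := by
  have := colim_preservesHomology hA
  have h : QuasiIso (familyComplexMap f) :=
    (HomologicalComplex.quasiIso_iff_evaluation _).2 fun i ↦ hf i.as
  -- By definition, `coproductComplexMap f` is the exact functor `colim` applied degreewise to
  -- `familyComplexMap f`.
  exact inferInstanceAs (QuasiIso
    (((colim : (Discrete I ⥤ A) ⥤ A).mapHomologicalComplex _).map (familyComplexMap f)))

/-- Null-homotopies of the components of a morphism from a degreewise coproduct give a
null-homotopy. -/
noncomputable def coproductComplexHomotopy {K : I → CochainComplex A ℤ} {L : CochainComplex A ℤ}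
    (f : coproductComplex K ⟶ L) (h : ∀ i, Homotopy (coproductComplexι K i ≫ f) 0) :
    Homotopy f 0 where
  hom m n := Limits.Sigma.desc fun i ↦ (h i).hom m n
  zero m n hmn := Limits.Sigma.hom_ext _ _ fun i ↦ by
    rw [Limits.Sigma.ι_desc, (h i).zero m n hmn, comp_zero]
  comm n := Limits.Sigma.hom_ext _ _ fun i ↦ by
    have := (h i).comm n
    rw [dNext_eq _ (show (ComplexShape.up ℤ).Rel n (n + 1) by simp),
      prevD_eq _ (show (ComplexShape.up ℤ).Rel (n - 1) n by simp)] at this ⊢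
    simpa using this

end Coproducts

/-! ### Coproducts in the derived category -/

section DerivedCoproducts

open DerivedCategory

variable {A : Type u} [Category.{v} A] [Abelian A] [HasDerivedCategory.{w} A]

/-- A morphism of complexes which vanishes in the derived category becomes null-homotopic after
precomposition with a quasi-isomorphism. -/
theorem exists_quasiIso_homotopy_zero {K L : CochainComplex A ℤ} (f : K ⟶ L)
    (hf : Q.map f = 0) : ∃ (K' : CochainComplex A ℤ) (s : K' ⟶ K), QuasiIso s ∧
      Nonempty (Homotopy (s ≫ f) 0) := by
  have hf' : Qh.map ((HomotopyCategory.quotient A (ComplexShape.up ℤ)).map f) =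
      Qh.map ((HomotopyCategory.quotient A (ComplexShape.up ℤ)).map 0) := by
    rw [← cancel_mono ((quotientCompQhIso A).hom.app L), quotientCompQhIso_hom_naturality,
      quotientCompQhIso_hom_naturality, hf, Functor.map_zero]
  rw [MorphismProperty.map_eq_iff_precomp Qh (HomotopyCategory.quasiIso A (ComplexShape.up ℤ))]
    at hf'
  obtain ⟨K', s, hs, h⟩ := hf'
  obtain ⟨K', rfl⟩ := HomotopyCategory.quotient_obj_surjective K'
  obtain ⟨s, rfl⟩ := (HomotopyCategory.quotient _ _).map_surjective s
  refine ⟨K', s, ?_, ⟨HomotopyCategory.homotopyOfEq _ _ ?_⟩⟩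
  · rwa [← isIso_Qh_map_iff, ← isIso_Q_map_iff_quasiIso] at *
  · rw [Functor.map_comp, h, ← Functor.map_comp, comp_zero]

variable {I : Type t} [HasColimitsOfShape (Discrete I) A]

/-- If coproducts preserve monomorphisms, then degreewise coproducts of complexes are coproducts
in the derived category. -/
theorem nonempty_isColimit_Q_coproductComplex
    (hA : ∀ (X Y : I → A) (f : ∀ i, X i ⟶ Y i) [∀ i, Mono (f i)], Mono (Limits.Sigma.map f))
    (K : I → CochainComplex A ℤ) :
    Nonempty (IsColimit (Cofan.mk (Q.obj (coproductComplex K))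
      fun i ↦ Q.map (coproductComplexι K i))) := by
  have desc {Y : DerivedCategory A} (f : ∀ i, Q.obj (K i) ⟶ Y) :
      ∃ g : Q.obj (coproductComplex K) ⟶ Y, ∀ i, Q.map (coproductComplexι K i) ≫ g = f i := by
    let e := Q.objObjPreimageIso Y
    -- The denominators `s i` are placed at the sources, so that they combine into the single
    -- quasi-isomorphism `coproductComplexMap s`.
    choose K' s hs g hg using fun i ↦ right_fac (f i ≫ e.inv)
    have : IsIso (Q.map (coproductComplexMap s)) := by
      rw [isIso_Q_map_iff_quasiIso]
      exact quasiIso_coproductComplexMap hA s fun i ↦ (isIso_Q_map_iff_quasiIso A (s i)).1 (hs i)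
    refine ⟨inv (Q.map (coproductComplexMap s)) ≫ Q.map (coproductComplexDesc g) ≫ e.hom,
      fun i ↦ ?_⟩
    rw [← cancel_epi (Q.map (s i)), ← Functor.map_comp_assoc, ← coproductComplexι_map,
      Functor.map_comp_assoc, IsIso.hom_inv_id_assoc, ← Functor.map_comp_assoc,
      coproductComplexι_desc, ← cancel_mono e.inv, assoc, assoc, hg i]
    simp
  have zero {Y : DerivedCategory A} (f : Q.obj (coproductComplex K) ⟶ Y)
      (hf : ∀ i, Q.map (coproductComplexι K i) ≫ f = 0) : f = 0 := by
    let e := Q.objObjPreimageIso Y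
    -- Here the denominator is placed at the target, so that `g` is a morphism of complexes out of
    -- the coproduct. Its components become null-homotopic after quasi-isomorphisms `r i`, whose
    -- coproduct then kills `g` in the derived category.
    obtain ⟨Y', g, s, hs, hg⟩ := left_fac (f ≫ e.inv)
    have hg' : Q.map g = f ≫ e.inv ≫ Q.map s := by
      rw [← assoc, hg, assoc, IsIso.inv_hom_id, comp_id]
    choose K' r hr h using fun i ↦ exists_quasiIso_homotopy_zero (coproductComplexι K i ≫ g)
      (by rw [Functor.map_comp, hg', reassoc_of% hf i, zero_comp])
    have : IsIso (Q.map (coproductComplexMap r)) := by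
      rw [isIso_Q_map_iff_quasiIso]
      exact quasiIso_coproductComplexMap hA r hr
    have hz := Q_map_eq_of_homotopy _ (coproductComplexHomotopy (coproductComplexMap r ≫ g)
      fun i ↦ (Homotopy.ofEq (by rw [reassoc_of% coproductComplexι_map r i])).trans (h i).some)
    rw [Functor.map_comp, hg', Functor.map_zero] at hz
    simpa using hz
  refine ⟨Cofan.IsColimit.mk _ (fun s ↦ (desc s.inj).choose) (fun s ↦ (desc s.inj).choose_spec)
    fun s m hm ↦ ?_⟩
  rw [← sub_eq_zero]
  refine zero _ fun i ↦ ?_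
  rw [Preadditive.comp_sub, (desc s.inj).choose_spec i, sub_eq_zero]
  exact hm i

/-- If coproducts preserve monomorphisms, then families of objects of `D^{≥ 0}` have coproducts
in the derived category, and these belong to `D^{≥ 0}`. -/
theorem exists_coproduct_ge
    (hA : ∀ (X Y : I → A) (f : ∀ i, X i ⟶ Y i) [∀ i, Mono (f i)], Mono (Limits.Sigma.map f))
    (X : I → DerivedCategory A)
    (hX : ∀ i, (TStructure.t : TStructure (DerivedCategory A)).ge 0 (X i)) :
    ∃ _ : HasCoproduct X, (TStructure.t : TStructure (DerivedCategory A)).ge 0 (∐ X) := by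
  -- Membership in `D^{≥ 0}` provides representatives that vanish in negative degrees, a property
  -- inherited by their degreewise coproduct.
  choose K e hK using hX
  obtain ⟨hc⟩ := nonempty_isColimit_Q_coproductComplex hA K
  have h₁ : HasCoproduct fun i ↦ Q.obj (K i) := ⟨⟨_, hc⟩⟩
  let α : Discrete.functor X ≅ Discrete.functor fun i ↦ Q.obj (K i) :=
    Discrete.natIso fun i ↦ e i.as
  have h₂ : HasCoproduct X := hasColimit_of_iso α
  refine ⟨h₂, coproductComplex K,
    HasColimit.isoOfNatIso α ≪≫
      (coproductIsCoproduct _).coconePointUniqueUpToIso hc, ?_⟩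
  rw [CochainComplex.isStrictlyGE_iff]
  intro n hn
  exact (IsZero.iff_id_eq_zero _).2 (Limits.Sigma.hom_ext _ _ fun i ↦
    ((K i).isZero_of_isStrictlyGE 0 n hn).eq_of_src _ _)

/-- If coproducts preserve monomorphisms, then the standard t-structure is smashing. -/
theorem isSmashing_of_mono_sigmaMap [HasCoproducts.{t} A]
    (hA : ∀ (I : Type t) (X Y : I → A) (f : ∀ i, X i ⟶ Y i) [∀ i, Mono (f i)],
      Mono (Limits.Sigma.map f)) :
    IsSmashing.{t} (TStructure.t : TStructure (DerivedCategory A)) := by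
  refine ⟨fun I X hX ↦ (exists_coproduct_ge (hA I) X hX).1, le_antisymm ?_ fun X hX ↦ ?_⟩
  · rintro X ⟨I, ⟨h⟩⟩
    obtain ⟨_, hge⟩ := exists_coproduct_ge (hA I) (h.diag.obj ∘ Discrete.mk)
      fun i ↦ h.prop_diag_obj ⟨i⟩
    exact ObjectProperty.prop_of_iso _ ((colimit.isColimit _).coconePointsIsoOfNatIso
      h.isColimit Discrete.natIsoFunctor.symm) hge
  -- Every object is a coproduct of the one-member family consisting of itself.
  · exact ⟨PUnit, ⟨(ObjectProperty.ColimitOfShape.colimit (Discrete.functor fun _ : PUnit ↦ X)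
      fun _ ↦ hX).ofIso (coproductUniqueIso _)⟩⟩

end DerivedCoproducts

end AET

theorem mainTheorem11 {A : Type u} [Category.{v} A] [Abelian A] [HasCoproducts.{v} A]
    [HasDerivedCategory.{w} A] (n : ℕ) (hn : 1 ≤ n)
    (hgl : AET.globalDimension
      (DerivedCategory.TStructure.t : TStructure (DerivedCategory A)) ≤ (n : ℕ∞)) :
    (AET.IsSmashing.{v} (DerivedCategory.TStructure.t : TStructure (DerivedCategory A)) ↔
      AET.Extriangulation.IsAET4.{v} (AET.extendedHeartExtriangulation
        (DerivedCategory.TStructure.t : TStructure (DerivedCategory A)) n)) ∧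
    (AET.IsSmashing.{v} (DerivedCategory.TStructure.t : TStructure (DerivedCategory A)) ↔
      AET.Extriangulation.IsAET35.{v} (AET.extendedHeartExtriangulation
        (DerivedCategory.TStructure.t : TStructure (DerivedCategory A)) n)) := by
  have h : AET.Extriangulation.IsAET35.{v} (AET.extendedHeartExtriangulation
      (DerivedCategory.TStructure.t : TStructure (DerivedCategory A)) n) →
      AET.IsSmashing.{v} (DerivedCategory.TStructure.t : TStructure (DerivedCategory A)) :=
    fun h ↦ AET.isSmashing_of_mono_sigmaMap fun _ _ _ f _ ↦ AET.mono_sigmaMap_of_isAET35 n h f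
  exact ⟨⟨fun hs ↦ hs.isAET4 n, fun h4 ↦ h h4.isAET35⟩, ⟨fun hs ↦ (hs.isAET4 n).isAET35, h⟩⟩
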